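/- Let $n\ge 1$ and let $K\subset\mathbb{R}^n$ be a smooth convex body, i.e. a compact convex set with non-empty interior and $C^\infty$ boundary. Let $B$ be the closed Euclidean unit ball, and for $q\in\partial K$ let $\nu_K(q)$ be the outward unit normal of $K$. A closed billiard trajectory in $K$ is given by a continuous, piecewise smooth loop $\gamma=(q,p)\colon \mathbb{R}/P\mathbb{Z}\to\partial(K\times B)$, $P>0$ (it is smooth near every point outside a null set and has one-sided derivatives everywhere), such that for some constant $d>0$: $\dot\gamma=d\,(-p,0)$ whenever $\gamma\in \mathrm{int}(K)\times\partial B$; $\dot\gamma=d\,(0,\nu_K(q))$ whenever $\gamma\in\partial K\times \mathrm{int}(B)$; and whenever $\gamma\in\partial K\times\partial B$, both one-sided derivatives of $\gamma$ have the form $\alpha(-p,0)+\beta(0,\nu_K(q))$ with $\alpha,\beta\ge 0$ and $(\alpha,\beta)\ne(0,0)$. (Thus both classical bouncing trajectories and gliding trajectories are allowed.) Its length is the Euclidean length of the closed curve $q$. Let $\xi(K)\in[0,\infty]$ be the length of the shortest closed billiard trajectory in $K$ (the infimum of the lengths of all closed billiard trajectories), and let $\mathrm{inrad}(K)$ be the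 inradius of $K$, i.e. the radius of the largest ball contained in $K$. Then $$\xi(K)\le 2(n+1)\,\mathrm{inrad}(K).$$ -/

import Mathlib

open scoped ENNReal ContDiff

/-- `K` has smooth (C^∞) boundary: near each boundary point, `K` is a sublevel set `{f ≤ 0}`
of a smooth function `f` whose differential does not vanish at that point. -/
def HasSmoothBoundary {n : ℕ} (K : Set (EuclideanSpace ℝ (Fin n))) : Prop :=
  ∀ x ∈ frontier K, ∃ (U : Set (EuclideanSpace ℝ (Fin n))) (f : EuclideanSpace ℝ (Fin n) → ℝ),
    IsOpen U ∧ x ∈ U ∧ ContDiffOn ℝ ∞ f U ∧ fderiv ℝ f x ≠ 0 ∧ ∀ y ∈ U, (y ∈ K ↔ f y ≤ 0)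

/-- `K` is a smooth convex body: compact, convex, with non-empty interior and smooth boundary. -/
structure IsSmoothConvexBody {n : ℕ} (K : Set (EuclideanSpace ℝ (Fin n))) : Prop where
  isCompact : IsCompact K
  convex : Convex ℝ K
  interior_nonempty : (interior K).Nonempty
  smooth : HasSmoothBoundary K

/-- The inradius of `K`: the radius of the largest ball contained in `K`. -/
noncomputable def inradius {n : ℕ} (K : Set (EuclideanSpace ℝ (Fin n))) : ℝ :=
  sSup {r : ℝ | 0 ≤ r ∧ ∃ x, Metric.closedBall x r ⊆ K}

/-- `ν` is an outward unit normal of the convex set `K` at `x`. At a boundary point of a smooth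
convex body it is unique, and it is the positive multiple of length one of the gradient of the
gauge function of `K` (taken with respect to any interior point). -/
def IsOutwardUnitNormal {n : ℕ} (K : Set (EuclideanSpace ℝ (Fin n)))
    (x ν : EuclideanSpace ℝ (Fin n)) : Prop :=
  ‖ν‖ = 1 ∧ ∀ y ∈ K, inner ℝ ν (y - x) ≤ 0

/-- The cone `{α (-p, 0) + β (0, ν) | α, β ≥ 0, (α, β) ≠ (0, 0)}` of admissible velocities at a
point `(q, p)` of `∂K × ∂B`, where `ν` is the outward unit normal of `K` at `q`, and `p` is the
outward unit normal of the Euclidean unit ball `B` at `p`. -/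
def IsBounceVelocity {n : ℕ} (K : Set (EuclideanSpace ℝ (Fin n)))
    (q p q' p' : EuclideanSpace ℝ (Fin n)) : Prop :=
  ∃ (α β : ℝ) (ν : EuclideanSpace ℝ (Fin n)), 0 ≤ α ∧ 0 ≤ β ∧ (α, β) ≠ (0, 0) ∧
    IsOutwardUnitNormal K q ν ∧ q' = -(α • p) ∧ p' = β • ν

/-- `t ↦ (q t, p t)` is a closed (Euclidean) billiard trajectory in `K`, parametrized with
period `P`: a piecewise smooth loop in the boundary of `K × B`, where `B` is the closed Euclidean
unit ball. While `q` is inside `K`, it moves along a straight line with velocity `-d • p`,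
`‖p‖ = 1`; while `p` is inside `B`, the point `q` stays on `∂K` and the momentum `p` moves in the
direction of the outward normal of `K` at `q`; on `∂K × ∂B` the one-sided velocities lie in the
cone spanned by these two directions. Both proper and gliding trajectories are included. -/
structure IsClosedBilliardTrajectory {n : ℕ} (K : Set (EuclideanSpace ℝ (Fin n))) (P : ℝ)
    (q p : ℝ → EuclideanSpace ℝ (Fin n)) : Prop where
  period_pos : 0 < P
  periodic_q : Function.Periodic q P
  periodic_p : Function.Periodic p P
  continuous_q : Continuous q
  continuous_p : Continuous p
  smooth_ae : ∀ᵐ t : ℝ, ContDiffAt ℝ ∞ q t ∧ ContDiffAt ℝ ∞ p t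
  mem_boundary : ∀ t, (q t, p t) ∈ frontier (K ×ˢ Metric.closedBall 0 1)
  velocity : ∃ d : ℝ, 0 < d ∧
    (∀ t, q t ∈ interior K → p t ∈ Metric.sphere 0 1 →
      HasDerivAt q (-(d • p t)) t ∧ HasDerivAt p 0 t) ∧
    (∀ t, q t ∈ frontier K → p t ∈ Metric.ball 0 1 →
      ∃ ν, IsOutwardUnitNormal K (q t) ν ∧ HasDerivAt q 0 t ∧ HasDerivAt p (d • ν) t)
  bounce_right : ∀ t, q t ∈ frontier K → p t ∈ Metric.sphere 0 1 →
    ∃ q' p', HasDerivWithinAt q q' (Set.Ici t) t ∧ HasDerivWithinAt p p' (Set.Ici t) t ∧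
      IsBounceVelocity K (q t) (p t) q' p'
  bounce_left : ∀ t, q t ∈ frontier K → p t ∈ Metric.sphere 0 1 →
    ∃ q' p', HasDerivWithinAt q q' (Set.Iic t) t ∧ HasDerivWithinAt p p' (Set.Iic t) t ∧
      IsBounceVelocity K (q t) (p t) q' p'

/-- `ξ(K)`, the length of the shortest closed billiard trajectory in `K`, as the infimum in
`[0, ∞]` of the Euclidean lengths of the `q`-components (it is `∞` if there is no trajectory). -/
noncomputable def shortestBilliardLength {n : ℕ} (K : Set (EuclideanSpace ℝ (Fin n))) : ℝ≥0∞ :=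
  sInf {L : ℝ≥0∞ | ∃ (P : ℝ) (q p : ℝ → EuclideanSpace ℝ (Fin n)),
    IsClosedBilliardTrajectory K P q p ∧ L = eVariationOn q (Set.Icc 0 P)}

/-! The argument follows the Bezdek–Bezdek principle: shortest closed polygons that cannot be
translated into the interior of `K` are billiard trajectories. It remains to exhibit a short polygon
that does not fit.

Such a polygon comes from Helly's theorem (`exists_not_fitsInto_of_closedBall`). For `r` above the
inradius no translate of the `r`-ball lies in `K`, so some `n + 1` points of that ball already fail
to fit. Joined cyclically, they span at most `n + 1` edges of length at most `2r`. Letting `r`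
decrease to the inradius gives the constant.

The principle itself is `exists_billiard_polygon`. Among non-fitting polygons of length at most `ℓ`,
minimize first the number of vertices, then the length. A slightly shrunk copy is shorter, hence
fits, so in the limit the minimizer fits into `K`. Separation in the product space yields normals `w
i` at its vertices with zero sum, and these certify that it does not fit. Minimality of the vertex
count makes every `w i` nonzero. Moving a vertex outward preserves the certificate, so the first
variation is nonnegative on a half space, which is the reflection law.

The polygon becomes a loop in the boundary of `K × B` by alternating flights, where `q` runs along
an edge and `p` rests at `-e i`, with jumps, where `q` rests and `p` moves along the normal to `-e
(i + 1)`. -/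

/-! ### Closed polygons and translation into a convex body. -/

section Tuples

open scoped Pointwise

variable {E : Type*} [NormedAddCommGroup E]

/-- Some translate of the tuple `x` lies in `U`. -/
def FitsInto {ι : Type*} (U : Set E) (x : ι → E) : Prop :=
  ∃ t : E, ∀ i, x i + t ∈ U

/-- The length of the closed polygon with vertices `x`. -/
noncomputable def cyclicLength {m : ℕ} [NeZero m] (x : ZMod m → E) : ℝ :=
  ∑ i, ‖x (i + 1) - x i‖

lemma FitsInto.mono {ι : Type*} {U V : Set E} {x : ι → E} (h : FitsInto U x) (hUV : U ⊆ V) :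
    FitsInto V x :=
  h.imp fun _ ht i => hUV (ht i)

lemma FitsInto.add_const_iff {ι : Type*} {U : Set E} {x : ι → E} (c : E) :
    FitsInto U (fun i => x i + c) ↔ FitsInto U x := by
  constructor
  · rintro ⟨t, ht⟩
    exact ⟨c + t, fun i => by simpa [add_assoc] using ht i⟩
  · rintro ⟨t, ht⟩
    exact ⟨t - c, fun i => by simpa [add_assoc] using ht i⟩

lemma fitsInto_of_subsingleton {ι : Type*} [Subsingleton ι] {U : Set E} (hU : U.Nonempty)
    (x : ι → E) : FitsInto U x := by
  obtain ⟨u, hu⟩ := hU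
  by_cases h : Nonempty ι
  · obtain ⟨i⟩ := h
    refine ⟨u - x i, fun j => ?_⟩
    rw [Subsingleton.elim j i]
    simpa using hu
  · exact ⟨0, fun i => (h ⟨i⟩).elim⟩

lemma cyclicLength_add_const {m : ℕ} [NeZero m] (x : ZMod m → E) (c : E) :
    cyclicLength (fun i => x i + c) = cyclicLength x := by
  simp [cyclicLength]

lemma cyclicLength_nonneg {m : ℕ} [NeZero m] (x : ZMod m → E) : 0 ≤ cyclicLength x :=
  Finset.sum_nonneg fun _ _ => norm_nonneg _

lemma cyclicLength_comp_add {m : ℕ} [NeZero m] (x : ZMod m → E) (c : ZMod m) :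
    cyclicLength (fun i => x (i + c)) = cyclicLength x := by
  unfold cyclicLength
  rw [← Equiv.sum_comp (Equiv.addRight c) fun i => ‖x (i + 1) - x i‖]
  simp [add_right_comm]

lemma cyclicLength_le_of_norm_le {m : ℕ} [NeZero m] {x : ZMod m → E} {r : ℝ}
    (hx : ∀ i, ‖x i‖ ≤ r) : cyclicLength x ≤ 2 * m * r := by
  calc cyclicLength x ≤ ∑ _i : ZMod m, (2 * r) :=
        Finset.sum_le_sum fun i _ => by
          linarith [norm_sub_le (x (i + 1)) (x i), hx i, hx (i + 1)]
    _ = 2 * m * r := by simp [ZMod.card]; ring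

/-- A crude diameter bound: it makes length-bounded polygons with a fixed vertex compact, and shows
that a polygon of length zero is a single point. -/
lemma norm_sub_zero_le_cyclicLength {m : ℕ} [NeZero m] (x : ZMod m → E) (i : ZMod m) :
    ‖x i - x 0‖ ≤ m * cyclicLength x := by
  have key : ∀ k : ℕ, ‖x (k : ZMod m) - x 0‖ ≤ k * cyclicLength x := by
    intro k
    induction k with
    | zero => simp
    | succ k ih =>
      have h1 : ‖x ((k : ZMod m) + 1) - x k‖ ≤ cyclicLength x :=
        Finset.single_le_sum (f := fun i => ‖x (i + 1) - x i‖) (fun _ _ => norm_nonneg _)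
          (Finset.mem_univ (k : ZMod m))
      have h2 := norm_sub_le_norm_sub_add_norm_sub (x ((k : ZMod m) + 1)) (x k) (x 0)
      push_cast
      linarith
  have h := key i.val
  rw [ZMod.natCast_zmod_val] at h
  refine h.trans (mul_le_mul_of_nonneg_right ?_ (cyclicLength_nonneg x))
  exact_mod_cast (ZMod.val_lt i).le

/-- Removing the last vertex of a closed polygon does not increase its length. -/
lemma cyclicLength_castSucc_le {m : ℕ} (x : ZMod (m + 2) → E) :
    cyclicLength (m := m + 1) (fun i => x (Fin.castSucc (n := m + 1) i)) ≤ cyclicLength x := by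
  have key : ∀ y : Fin (m + 2) → E,
      ∑ i : Fin (m + 1), ‖y (i + 1).castSucc - y i.castSucc‖ ≤
        ∑ i : Fin (m + 2), ‖y (i + 1) - y i‖ := by
    intro y
    -- After the common edges are split off, the two edges at the last vertex face the single edge
    -- that closes the shorter polygon.
    rw [Fin.sum_univ_castSucc, Fin.sum_univ_castSucc (n := m + 1), Fin.sum_univ_castSucc (n := m)]
    simp only [Fin.coeSucc_eq_succ, Fin.succ_last, Fin.last_add_one, Fin.castSucc_zero,
      Fin.succ_castSucc]
    have := norm_sub_le_norm_sub_add_norm_sub (y 0) (y (Fin.last (m + 1)))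
      (y (Fin.last m).castSucc)
    linarith
  exact key x

/-- A vertex of a closed polygon can be removed without increasing the length. -/
lemma exists_cyclicLength_le_omit {m : ℕ} (x : ZMod (m + 2) → E) (j : ZMod (m + 2)) :
    ∃ σ : ZMod (m + 1) → ZMod (m + 2), (∀ i, i ≠ j → ∃ k, σ k = i) ∧
      cyclicLength (x ∘ σ) ≤ cyclicLength x := by
  let s : ZMod (m + 1) → ZMod (m + 2) := Fin.castSucc (n := m + 1)
  -- The last vertex has index `-1`, so rotating by `j + 1` makes `j` the omitted one.
  refine ⟨fun i => s i + (j + 1), ?_, ?_⟩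
  · intro i hi
    let k : Fin (m + 2) := (i - (j + 1) : ZMod (m + 2))
    have hne : k ≠ Fin.last (m + 1) := by
      intro h
      have h2 : k + 1 = 0 := by rw [h]; exact Fin.last_add_one (m + 1)
      have h3 : i - (j + 1) + 1 = 0 := h2
      exact hi (by linear_combination h3)
    refine ⟨k.castPred hne, ?_⟩
    have h4 : s (k.castPred hne) = i - (j + 1) := Fin.castSucc_castPred k hne
    change s (k.castPred hne) + (j + 1) = i
    rw [h4, sub_add_cancel]
  · rw [← cyclicLength_comp_add x (j + 1)]
    exact cyclicLength_castSucc_le fun i => x (i + (j + 1))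

lemma continuous_cyclicLength {m : ℕ} [NeZero m] :
    Continuous (cyclicLength : (ZMod m → E) → ℝ) := by
  unfold cyclicLength
  fun_prop

lemma isOpen_setOf_fitsInto {ι : Type*} [Finite ι] {U : Set E} (hU : IsOpen U) :
    IsOpen {x : ι → E | FitsInto U x} := by
  have : {x : ι → E | FitsInto U x} = ⋃ t : E, ⋂ i, {x | x i + t ∈ U} := by
    ext x; simp [FitsInto]
  rw [this]
  exact isOpen_iUnion fun t => isOpen_iInter_of_finite fun i => hU.preimage (by fun_prop)

variable [NormedSpace ℝ E]

lemma cyclicLength_smul {m : ℕ} [NeZero m] (s : ℝ) (hs : 0 ≤ s) (x : ZMod m → E) :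
    cyclicLength (s • x) = s * cyclicLength x := by
  simp [cyclicLength, Finset.mul_sum, ← smul_sub, norm_smul, abs_of_nonneg hs]

variable [FiniteDimensional ℝ E]

/-- Among the closed polygons that do not fit into an open set, there is a shortest one. -/
lemma exists_minimal_not_fitsInto {m : ℕ} [NeZero m] {U : Set E} (hU : IsOpen U)
    {x₀ : ZMod m → E} (hx₀ : ¬ FitsInto U x₀) :
    ∃ x : ZMod m → E, ¬ FitsInto U x ∧
      ∀ y : ZMod m → E, ¬ FitsInto U y → cyclicLength x ≤ cyclicLength y := by
  have := FiniteDimensional.proper_real E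
  -- Both fitting and length are translation invariant, so fixing `x 0 = 0` costs nothing and makes
  -- the domain of minimization bounded.
  set S : Set (ZMod m → E) := {x | ¬ FitsInto U x} ∩
    ({x | x 0 = 0} ∩ {x | cyclicLength x ≤ cyclicLength x₀}) with hS
  have hclosed : IsClosed S :=
    (isOpen_setOf_fitsInto hU).isClosed_compl.inter
      ((isClosed_eq (by fun_prop) continuous_const).inter
        (isClosed_le continuous_cyclicLength continuous_const))
  have hbdd : S ⊆ Metric.closedBall 0 (m * cyclicLength x₀) := by
    rintro x ⟨-, h0, hl⟩
    simp only [Set.mem_ofPred_eq] at h0 hl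
    rw [mem_closedBall_zero_iff]
    refine (pi_norm_le_iff_of_nonneg (by have := cyclicLength_nonneg x₀; positivity)).2 fun i => ?_
    have := norm_sub_zero_le_cyclicLength x i
    rw [h0, sub_zero] at this
    exact this.trans (mul_le_mul_of_nonneg_left hl (Nat.cast_nonneg m))
  have hcomp : IsCompact S := (isCompact_closedBall _ _).of_isClosed_subset hclosed hbdd
  have hmem : ∀ y : ZMod m → E, ¬ FitsInto U y → cyclicLength y ≤ cyclicLength x₀ →
      (fun i => y i + -y 0) ∈ S := fun y hy hl =>
    ⟨fun h => hy ((FitsInto.add_const_iff _).1 h), by simp, by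
      simpa only [Set.mem_ofPred_eq, cyclicLength_add_const] using hl⟩
  obtain ⟨x, hxS, hx⟩ := hcomp.exists_isMinOn ⟨_, hmem x₀ hx₀ le_rfl⟩
    continuous_cyclicLength.continuousOn
  refine ⟨x, hxS.1, fun y hy => ?_⟩
  rcases le_total (cyclicLength y) (cyclicLength x₀) with h | h
  · have h1 : cyclicLength x ≤ cyclicLength fun i => y i + -y 0 := hx (hmem y hy h)
    rwa [cyclicLength_add_const] at h1
  · exact (hxS.2.2 : _ ≤ _).trans h

/-- The fitting tuples are the sum of a compact product of copies of `K` and the diagonal subspace,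
which is closed. -/
lemma isClosed_setOf_fitsInto {ι : Type*} [Finite ι] {K : Set E} (hK : IsCompact K) :
    IsClosed {x : ι → E | FitsInto K x} := by
  have : {x : ι → E | FitsInto K x} =
      Set.univ.pi (fun _ : ι => K) +
        (LinearMap.range (LinearMap.pi fun _ : ι => (LinearMap.id : E →ₗ[ℝ] E)) :
          Set (ι → E)) := by
    ext x
    simp only [FitsInto, Set.mem_ofPred_eq, Set.mem_add, SetLike.mem_coe, LinearMap.mem_range]
    constructor
    · rintro ⟨t, ht⟩
      refine ⟨fun i => x i + t, fun i _ => ht i, _, ⟨-t, rfl⟩, ?_⟩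
      ext i; simp
    · rintro ⟨a, ha, _, ⟨t, rfl⟩, rfl⟩
      exact ⟨-t, fun i => by simpa using ha i trivial⟩
  rw [this]
  exact (Submodule.closed_of_finiteDimensional _).add_left_of_isCompact
    (isCompact_univ_pi fun _ => hK)

/-- A shortest closed polygon not fitting into the interior of `K` fits into `K`. -/
lemma fitsInto_of_minimal {m : ℕ} [NeZero m] {K : Set E} (hK : IsCompact K)
    (hne : (interior K).Nonempty) {x : ZMod m → E} (hx : ¬ FitsInto (interior K) x)
    (hmin : ∀ y : ZMod m → E, ¬ FitsInto (interior K) y → cyclicLength x ≤ cyclicLength y) :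
    FitsInto K x := by
  have hpos : 0 < cyclicLength x := by
    refine (cyclicLength_nonneg x).lt_of_ne fun h => hx ?_
    obtain ⟨u, hu⟩ := hne
    refine ⟨u - x 0, fun i => ?_⟩
    have := norm_sub_zero_le_cyclicLength x i
    rw [← h, mul_zero, norm_le_zero_iff, sub_eq_zero] at this
    simpa [this] using hu
  have hmem : ∀ s ∈ Set.Ioo (0 : ℝ) 1, s • x ∈ {x : ZMod m → E | FitsInto K x} := by
    intro s hs
    by_contra hcon
    have h1 := hmin (s • x) fun h => hcon (h.mono interior_subset)
    rw [cyclicLength_smul s hs.1.le] at h1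
    nlinarith [hs.2]
  have hlim : Filter.Tendsto (fun s : ℝ => s • x) (nhdsWithin 1 (Set.Iio 1)) (nhds x) := by
    have : Continuous fun s : ℝ => s • x := by fun_prop
    simpa using (this.tendsto 1).mono_left nhdsWithin_le_nhds
  refine (isClosed_setOf_fitsInto hK).mem_of_tendsto hlim ?_
  filter_upwards [Ioo_mem_nhdsLT (zero_lt_one' ℝ)] with s hs using hmem s hs

/-- If no ball of radius `r` is contained in the compact convex set `K`, then some `d + 1` points
of the ball of radius `r` do not fit into `K`. -/
lemma exists_not_fitsInto_of_closedBall {K : Set E} (hK : IsCompact K) (hconv : Convex ℝ K)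
    {r : ℝ} (hr : 0 ≤ r) (h : ∀ c, ¬ Metric.closedBall c r ⊆ K) :
    ∃ x : ZMod (Module.finrank ℝ E + 1) → E, (∀ i, ‖x i‖ ≤ r) ∧ ¬ FitsInto K x := by
  by_contra! hcon
  -- A common point of all the sets `K - u` is a vector translating the whole ball into `K`.
  set F : Metric.closedBall (0 : E) r → Set E := fun u => (fun t => (u : E) + t) ⁻¹' K
  have hF : (⋂ u, F u).Nonempty := by
    refine Convex.helly_theorem_compact' (𝕜 := ℝ)
      (fun u => ?_) (fun u => ?_) fun I hI => ?_
    · exact hconv.translate_preimage_right (u : E)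
    · exact (Homeomorph.addLeft (u : E)).isCompact_preimage.2 hK
    · have : Nonempty (Metric.closedBall (0 : E) r) := ⟨⟨0, by simpa using hr⟩⟩
      rcases I.eq_empty_or_nonempty with rfl | hne
      · simp
      have : Nonempty I := hne.to_subtype
      obtain ⟨g⟩ : Nonempty (I ↪ ZMod (Module.finrank ℝ E + 1)) :=
        Function.Embedding.nonempty_of_card_le (by simpa [ZMod.card] using hI)
      -- A family with fewer members is padded to a full tuple by repeating points.
      obtain ⟨t, ht⟩ := hcon (fun i => ((Function.invFun g i : I) : Metric.closedBall (0 : E) r))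
        fun i => by
          exact mem_closedBall_zero_iff.1 (Function.invFun g i : I).1.2
      refine ⟨t, ?_⟩
      simp only [Set.mem_iInter]
      intro u hu
      have : (((Function.invFun g (g ⟨u, hu⟩) : I) : Metric.closedBall (0 : E) r) : E) + t ∈ K :=
        ht (g ⟨u, hu⟩)
      rwa [Function.leftInverse_invFun g.injective] at this
  obtain ⟨t, ht⟩ := hF
  refine h t fun y hy => ?_
  have := Set.mem_iInter.1 ht ⟨y - t, by simpa [dist_eq_norm] using hy⟩
  simpa [F] using this

end Tuples

/-! ### Outward normals, first variation and the reflection law. -/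

section Normals

open RealInnerProductSpace

variable {E : Type*} [NormedAddCommGroup E] [InnerProductSpace ℝ E]

/-- `w` is an outward normal, possibly zero, of `K` at `q`. -/
def IsOutwardNormal (K : Set E) (q w : E) : Prop :=
  ∀ y ∈ K, ⟪w, y - q⟫ ≤ 0

/-- An interior point can be pushed a little in direction `w` without leaving `K`, which leaves room
for strict inequality. -/
lemma IsOutwardNormal.inner_neg {K : Set E} {q w y : E} (h : IsOutwardNormal K q w) (hw : w ≠ 0)
    (hy : y ∈ interior K) : ⟪w, y - q⟫ < 0 := by
  have hlim : Filter.Tendsto (fun s : ℝ => y + s • w) (nhdsWithin 0 (Set.Ioi 0)) (nhds y) := by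
    have : Continuous fun s : ℝ => y + s • w := by fun_prop
    simpa using (this.tendsto 0).mono_left nhdsWithin_le_nhds
  obtain ⟨s, hs, hs0⟩ := ((hlim.eventually (mem_interior_iff_mem_nhds.1 hy)).and
    self_mem_nhdsWithin).exists
  have h1 := h _ hs
  rw [add_sub_right_comm, inner_add_right, inner_smul_right] at h1
  have h2 : 0 < ⟪w, w⟫ := real_inner_self_pos.2 hw
  have h3 : 0 < s := hs0
  nlinarith [mul_pos h3 h2]

lemma IsOutwardNormal.notMem_interior {K : Set E} {q w : E} (h : IsOutwardNormal K q w)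
    (hw : w ≠ 0) : q ∉ interior K := fun hq => by
  simpa using h.inner_neg hw hq

/-- Normals with zero sum obstruct translation into the interior. -/
lemma not_forall_add_mem_interior {ι : Type*} [Fintype ι] {K : Set E} {q w x : ι → E}
    (hw : ∀ i, IsOutwardNormal K (q i) (w i)) (hsum : ∑ i, w i = 0) (hne : ∃ i, w i ≠ 0)
    (hx : ∀ i, 0 ≤ ⟪w i, x i - q i⟫) (t : E) :
    ¬ ∀ i, w i ≠ 0 → x i + t ∈ interior K := by
  intro h
  have hneg : ∀ i, w i ≠ 0 → ⟪w i, t⟫ < 0 := by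
    intro i hi
    have h1 := (hw i).inner_neg hi (h i hi)
    rw [add_sub_right_comm, inner_add_right] at h1
    linarith [hx i]
  have hlt : ∑ i, ⟪w i, t⟫ < ∑ _i : ι, (0 : ℝ) := by
    refine Finset.sum_lt_sum (fun i _ => ?_) ?_
    · by_cases hi : w i = 0
      · simp [hi]
      · exact (hneg i hi).le
    · obtain ⟨i, hi⟩ := hne
      exact ⟨i, Finset.mem_univ i, hneg i hi⟩
  rw [← sum_inner, hsum] at hlt
  simp at hlt

/-- If points of a convex body do not fit into its interior, there are outward normals at these
points with zero sum, not all of them zero. -/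
lemma exists_outwardNormals [CompleteSpace E] {ι : Type*} [Fintype ι] {K : Set E}
    (hconv : Convex ℝ K) (hne : (interior K).Nonempty) {q : ι → E} (hq : ∀ i, q i ∈ K)
    (hfit : ¬ FitsInto (interior K) q) :
    ∃ w : ι → E, (∀ i, IsOutwardNormal K (q i) (w i)) ∧ ∑ i, w i = 0 ∧ ∃ i, w i ≠ 0 := by
  classical
  -- Not fitting says that, in the product space, the open convex set of tuples in `interior K`
  -- misses the affine space of translates of `q`. The components of a separating functional are the
  -- normals; its boundedness below along the diagonal forces their sum to vanish.
  have hdisj : Disjoint (Set.univ.pi fun _ : ι => interior K)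
      (Set.range fun t : E => fun i => q i + t) := by
    rw [Set.disjoint_left]
    rintro _ ha ⟨t, rfl⟩
    exact hfit ⟨t, fun i => ha i trivial⟩
  have hconv' : Convex ℝ (Set.range fun t : E => fun i => q i + t) := by
    rintro _ ⟨s, rfl⟩ _ ⟨t, rfl⟩ a b ha hb hab
    refine ⟨a • s + b • t, ?_⟩
    ext i
    simp only [Pi.add_apply, Pi.smul_apply, smul_add]
    nth_rw 1 [← one_smul ℝ (q i), ← hab]
    module
  obtain ⟨f, u, hf, hu⟩ := geometric_hahn_banach_open
    (convex_pi fun _ _ => hconv.interior) (isOpen_set_pi Set.finite_univ fun _ _ => isOpen_interior)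
    hconv' hdisj
  let φ : ι → StrongDual ℝ E := fun i =>
    f.comp (ContinuousLinearMap.single ℝ (fun _ : ι => E) i)
  let w : ι → E := fun i => (InnerProductSpace.toDual ℝ E).symm (φ i)
  have hwi : ∀ i v, ⟪w i, v⟫ = f (Pi.single i v) := fun i v => by
    simp [w, φ]
  have hfsum : ∀ v : ι → E, f v = ∑ i, ⟪w i, v i⟫ := fun v => by
    simp_rw [hwi]
    rw [← map_sum, Finset.univ_sum_single]
  have hu' : ∀ t : E, u ≤ f q + f (fun _ => t) := fun t => by
    rw [← map_add]; exact hu _ ⟨t, rfl⟩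
  have hle : ∀ a : ι → E, (∀ i, a i ∈ K) → f a ≤ f q := by
    intro a ha
    have hcl : a ∈ closure (Set.univ.pi fun _ : ι => interior K) := by
      rw [closure_pi_set]
      intro i _
      rw [hconv.closure_interior_eq_closure_of_nonempty_interior hne]
      exact subset_closure (ha i)
    refine closure_minimal (fun b hb => ?_) (isClosed_le f.continuous continuous_const) hcl
    have h1 := hu' 0
    have h2 : f (fun _ : ι => (0 : E)) = 0 := map_zero f
    have := hf b hb
    simp only [Set.mem_ofPred_eq]
    linarith
  refine ⟨w, fun i y hy => ?_, ?_, ?_⟩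
  · have h1 := hle (Function.update q i y) fun j => by
      by_cases h : j = i
      · subst h; simpa using hy
      · simpa [h] using hq j
    have h2 : Function.update q i y = q + Pi.single i (y - q i) := by
      ext j
      by_cases h : j = i
      · subst h; simp
      · simp [h]
    rw [h2, map_add, ← hwi] at h1
    linarith
  · by_contra hsum
    have h1 : ∀ c : ℝ, u ≤ f q + c * ⟪∑ i, w i, ∑ i, w i⟫ := fun c => by
      have h2 := hu' (c • ∑ i, w i)
      rw [hfsum (fun _ => c • ∑ i, w i), ← sum_inner, inner_smul_right] at h2
      exact h2
    have h2 : 0 < ⟪∑ i, w i, ∑ i, w i⟫ := real_inner_self_pos.2 hsum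
    -- With this `c` the right-hand side equals `u - 1`.
    have h3 := h1 ((u - f q - 1) / ⟪∑ i, w i, ∑ i, w i⟫)
    rw [div_mul_cancel₀ _ h2.ne'] at h3
    linarith
  · by_contra! hcon
    obtain ⟨c, hc⟩ := hne
    have h1 := hf (fun _ => c) fun i _ => hc
    have h2 := hu' 0
    have h3 : f (fun _ : ι => (0 : E)) = 0 := map_zero f
    rw [hfsum] at h1 h2
    simp only [hcon, inner_zero_left, Finset.sum_const_zero] at h1 h2
    linarith

/-- Every boundary point of a convex body has an outward unit normal. -/
lemma exists_unit_outwardNormal [CompleteSpace E] {K : Set E} (hconv : Convex ℝ K)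
    (hne : (interior K).Nonempty) {q : E} (hq : q ∉ interior K) :
    ∃ w, ‖w‖ = 1 ∧ IsOutwardNormal K q w := by
  obtain ⟨f, hf⟩ := geometric_hahn_banach_open_point hconv.interior isOpen_interior hq
  set v : E := (InnerProductSpace.toDual ℝ E).symm f with hv
  have hvi : ∀ y, ⟪v, y⟫ = f y := fun y => by simp [hv]
  have hv0 : v ≠ 0 := by
    intro h
    obtain ⟨c, hc⟩ := hne
    have := hf c hc
    rw [← hvi, ← hvi, h] at this
    simp at this
  have hn : IsOutwardNormal K q v := by
    intro y hy
    have hcl : y ∈ closure (interior K) := by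
      rw [hconv.closure_interior_eq_closure_of_nonempty_interior hne]
      exact subset_closure hy
    refine closure_minimal (t := {y | ⟪v, y - q⟫ ≤ 0}) (fun b hb => ?_)
      (isClosed_le (by fun_prop) continuous_const) hcl
    have := hf b hb
    rw [Set.mem_ofPred_eq, hvi, map_sub]
    linarith
  refine ⟨‖v‖⁻¹ • v, norm_smul_inv_norm hv0, fun y hy => ?_⟩
  rw [real_inner_smul_left]
  exact mul_nonpos_of_nonneg_of_nonpos (by positivity) (hn y hy)

/-- A one-sided Taylor bound for the norm, from `2xy ≤ x² + y²`. An upper bound suffices for a first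
variation at a minimum, so the norm need not be differentiated. -/
lemma norm_add_smul_le {a v : E} (ha : a ≠ 0) (s : ℝ) :
    ‖a + s • v‖ ≤ ‖a‖ + s * ⟪‖a‖⁻¹ • a, v⟫ + s ^ 2 * (‖v‖ ^ 2 / (2 * ‖a‖)) := by
  have h0 : 0 < ‖a‖ := norm_pos_iff.2 ha
  have h1 : ‖a + s • v‖ ^ 2 = ‖a‖ ^ 2 + 2 * s * ⟪a, v⟫ + s ^ 2 * ‖v‖ ^ 2 := by
    rw [norm_add_sq_real, inner_smul_right, norm_smul, mul_pow, Real.norm_eq_abs, sq_abs]; ring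
  have h2 : 2 * ‖a‖ * ‖a + s • v‖ ≤ ‖a‖ ^ 2 + ‖a + s • v‖ ^ 2 := two_mul_le_add_sq _ _
  rw [h1] at h2
  have h3 : ‖a‖ + s * ⟪‖a‖⁻¹ • a, v⟫ + s ^ 2 * (‖v‖ ^ 2 / (2 * ‖a‖)) =
      (‖a‖ ^ 2 + (‖a‖ ^ 2 + 2 * s * ⟪a, v⟫ + s ^ 2 * ‖v‖ ^ 2)) / (2 * ‖a‖) := by
    rw [real_inner_smul_left]; field_simp; ring
  rw [h3, le_div_iff₀ (by positivity)]
  linarith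

/-- First variation of the length of a closed polygon under a one-sided variation. -/
lemma sum_inner_nonneg_of_cyclicLength_le {m : ℕ} [NeZero m] {q V : ZMod m → E}
    (hq : ∀ i, q (i + 1) ≠ q i)
    (hmin : ∀ s : ℝ, 0 < s → cyclicLength q ≤ cyclicLength (q + s • V)) :
    0 ≤ ∑ i, ⟪‖q (i + 1) - q i‖⁻¹ • (q (i + 1) - q i), V (i + 1) - V i⟫ := by
  set A := ∑ i, ⟪‖q (i + 1) - q i‖⁻¹ • (q (i + 1) - q i), V (i + 1) - V i⟫ with hA
  set B := ∑ i, ‖V (i + 1) - V i‖ ^ 2 / (2 * ‖q (i + 1) - q i‖) with hB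
  have key : ∀ s : ℝ, 0 < s → 0 ≤ A + s * B := by
    intro s hs
    have h1 : cyclicLength (q + s • V) ≤ cyclicLength q + s * A + s ^ 2 * B := by
      rw [hA, hB, cyclicLength, cyclicLength, Finset.mul_sum, Finset.mul_sum,
        ← Finset.sum_add_distrib, ← Finset.sum_add_distrib]
      refine Finset.sum_le_sum fun i _ => ?_
      refine le_trans (le_of_eq ?_) (norm_add_smul_le (sub_ne_zero.2 (hq i)) s)
      congr 1
      simp only [Pi.add_apply, Pi.smul_apply]
      module
    have h2 := hmin s hs
    have h3 : 0 ≤ s * (A + s * B) := by linarith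
    exact nonneg_of_mul_nonneg_right h3 hs
  have hlim : Filter.Tendsto (fun s : ℝ => A + s * B) (nhdsWithin 0 (Set.Ioi 0)) (nhds A) := by
    have : Continuous fun s : ℝ => A + s * B := by fun_prop
    simpa using (this.tendsto 0).mono_left nhdsWithin_le_nhds
  refine ge_of_tendsto hlim ?_
  filter_upwards [self_mem_nhdsWithin] with s hs using key s hs

/-- A vector having nonnegative inner product with a half space is a nonnegative multiple of the
inner normal of the half space. -/
lemma exists_nonneg_smul_eq_of_inner_nonneg {g w : E} (hw : w ≠ 0)
    (h : ∀ v, 0 ≤ ⟪w, v⟫ → 0 ≤ ⟪g, v⟫) : ∃ c : ℝ, 0 ≤ c ∧ g = c • w := by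
  have hw2 : 0 < ⟪w, w⟫ := real_inner_self_pos.2 hw
  refine ⟨⟪g, w⟫ / ⟪w, w⟫, div_nonneg (h w hw2.le) hw2.le, ?_⟩
  set c := ⟪g, w⟫ / ⟪w, w⟫ with hc
  have h1 : ⟪w, g - c • w⟫ = 0 := by
    rw [inner_sub_right, inner_smul_right, hc, div_mul_cancel₀ _ hw2.ne', real_inner_comm, sub_self]
  -- The component of `g` orthogonal to `w` is tested against its own negative, which lies on the
  -- boundary of the half space.
  have h2 := h (-(g - c • w)) (by rw [inner_neg_right, h1, neg_zero])
  rw [inner_neg_right] at h2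
  have h3 : ⟪g - c • w, g - c • w⟫ = ⟪g, g - c • w⟫ := by
    rw [inner_sub_left, real_inner_smul_left, h1, mul_zero, sub_zero]
  rw [← sub_eq_zero]
  by_contra hne
  linarith [real_inner_self_pos.2 hne]

variable [FiniteDimensional ℝ E]

/-- If some closed polygon of length at most `ℓ` does not fit into the interior of the convex body
`K`, then there is such a polygon inscribed in `K` satisfying the billiard reflection law
with a proper reflection at every vertex. -/
lemma exists_billiard_polygon {K : Set E} (hK : IsCompact K) (hconv : Convex ℝ K)
    (hne : (interior K).Nonempty) {ℓ : ℝ} {m₀ : ℕ} {x₀ : ZMod (m₀ + 1) → E}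
    (hx₀ : ¬ FitsInto (interior K) x₀) (hℓ : cyclicLength x₀ ≤ ℓ) :
    ∃ (m : ℕ) (q e ν : ZMod (m + 1) → E) (c : ZMod (m + 1) → ℝ), cyclicLength q ≤ ℓ ∧
      (∀ i, q i ∈ frontier K) ∧ (∀ i, q (i + 1) ≠ q i) ∧
      (∀ i, q (i + 1) = q i + ‖q (i + 1) - q i‖ • e i) ∧ (∀ i, ‖e i‖ = 1) ∧
      (∀ i, ‖ν i‖ = 1) ∧ (∀ i, IsOutwardNormal K (q i) (ν i)) ∧ (∀ i, 0 < c i) ∧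
      ∀ i, e i - e (i + 1) = c (i + 1) • ν (i + 1) := by
  classical
  have hex : ∃ m : ℕ, ∃ x : ZMod (m + 1) → E, ¬ FitsInto (interior K) x ∧ cyclicLength x ≤ ℓ :=
    ⟨m₀, x₀, hx₀, hℓ⟩
  -- The number of vertices is minimized before the length, so that dropping any vertex yields a
  -- polygon that fits.
  obtain ⟨x₁, hx₁, hx₁ℓ⟩ := Nat.find_spec hex
  have hmin' := fun k (hk : k < Nat.find hex) => Nat.find_min hex hk
  revert x₁ hmin'
  generalize Nat.find hex = m
  intro x₁ hx₁ hx₁ℓ hm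
  rcases m with _ | m
  · have : Subsingleton (ZMod (0 + 1)) := inferInstanceAs (Subsingleton (Fin 1))
    exact (hx₁ (fitsInto_of_subsingleton hne x₁)).elim
  obtain ⟨y, hy, hymin⟩ := exists_minimal_not_fitsInto isOpen_interior hx₁
  obtain ⟨t, ht⟩ := fitsInto_of_minimal hK hne hy hymin
  obtain ⟨q, hqdef⟩ : ∃ q : ZMod (m + 1 + 1) → E, q = fun i => y i + t := ⟨_, rfl⟩
  replace ht : ∀ i, q i ∈ K := fun i => by rw [hqdef]; exact ht i
  have hq : ¬ FitsInto (interior K) q := fun h => hy ((FitsInto.add_const_iff t).1 (hqdef ▸ h))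
  have hlen : cyclicLength q = cyclicLength y := hqdef ▸ cyclicLength_add_const y t
  have hqℓ : cyclicLength q ≤ ℓ := by rw [hlen]; exact (hymin x₁ hx₁).trans hx₁ℓ
  have hqmin : ∀ z : ZMod (m + 1 + 1) → E, ¬ FitsInto (interior K) z →
      cyclicLength q ≤ cyclicLength z := by rw [hlen]; exact hymin
  have homit : ∀ j, ∃ t, ∀ i, i ≠ j → q i + t ∈ interior K := by
    intro j
    obtain ⟨σ, hσ, hσl⟩ := exists_cyclicLength_le_omit q j
    by_contra hcon
    refine hm m (Nat.lt_succ_self m) ⟨q ∘ σ, ?_, hσl.trans hqℓ⟩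
    rintro ⟨t, ht⟩
    refine hcon ⟨t, fun i hi => ?_⟩
    obtain ⟨k, rfl⟩ := hσ i hi
    exact ht k
  obtain ⟨w, hw, hwsum, hwne⟩ := exists_outwardNormals hconv hne ht hq
  have hw0 : ∀ i, w i ≠ 0 := by
    intro j hj
    obtain ⟨t, ht⟩ := homit j
    -- If `w j = 0`, the normals at the other vertices alone obstruct translation, although those
    -- vertices fit once `j` is dropped.
    refine not_forall_add_mem_interior hw hwsum hwne (x := q) (fun i => by simp) t fun i hi => ?_
    exact ht i fun hij => hi (hij ▸ hj)
  have hone : (1 : ZMod (m + 1 + 1)) ≠ 0 := by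
    have : Nontrivial (ZMod (m + 1 + 1)) := inferInstanceAs (Nontrivial (Fin (m + 2)))
    exact one_ne_zero
  -- By convexity, a vertex between its neighbours would follow them into the interior.
  have hseg : ∀ i, q (i + 1) ∉ segment ℝ (q i) (q (i + 1 + 1)) := by
    intro i hi
    obtain ⟨t, ht⟩ := homit (i + 1)
    refine hq ⟨t, fun j => ?_⟩
    by_cases hj : j = i + 1
    · subst hj
      obtain ⟨a, b, ha, hb, hab, habq⟩ := hi
      have h1 : q i + t ∈ interior K := ht i (by simpa using hone)
      have h2 : q (i + 1 + 1) + t ∈ interior K := ht (i + 1 + 1) (by simpa using hone)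
      have h3 := hconv.interior h1 h2 ha hb hab
      convert h3 using 1
      rw [← habq]
      nth_rw 1 [← one_smul ℝ t, ← hab]
      module
    · exact ht j hj
  have hqne : ∀ i, q (i + 1) ≠ q i := fun i h => hseg i (h ▸ left_mem_segment ℝ _ _)
  set e : ZMod (m + 1 + 1) → E := fun i => ‖q (i + 1) - q i‖⁻¹ • (q (i + 1) - q i) with he
  have hnorm : ∀ i, 0 < ‖q (i + 1) - q i‖ := fun i => norm_pos_iff.2 (sub_ne_zero.2 (hqne i))
  have hstep : ∀ i, q (i + 1) = q i + ‖q (i + 1) - q i‖ • e i := fun i => by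
    rw [he, smul_inv_smul₀ (hnorm i).ne']; abel
  have hrefl : ∀ i, ∃ c : ℝ, 0 ≤ c ∧ e i - e (i + 1) = c • w (i + 1) := by
    intro j
    refine exists_nonneg_smul_eq_of_inner_nonneg (hw0 _) fun v hv => ?_
    -- Only vertex `j + 1` moves, in a direction on the outer side of its normal, so the same
    -- normals still rule out fitting.
    have h1 := sum_inner_nonneg_of_cyclicLength_le (V := Pi.single (j + 1) v) hqne fun s hs => by
      refine hqmin _ ?_
      rintro ⟨t, ht⟩
      refine not_forall_add_mem_interior hw hwsum hwne (fun i => ?_) t fun i _ => ht i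
      by_cases hi : i = j + 1
      · subst hi
        simpa [inner_smul_right] using mul_nonneg hs.le hv
      · simp [hi]
    change 0 ≤ ∑ i, ⟪e i, _⟫ at h1
    simp_rw [inner_sub_right] at h1
    rw [Finset.sum_sub_distrib, Finset.sum_eq_single j, Finset.sum_eq_single (j + 1)] at h1
    · simpa [inner_sub_left] using h1
    · intro i _ hi; simp [hi]
    · simp
    · intro i _ hi
      rw [Pi.single_eq_of_ne (by simpa using hi)]
      simp
    · simp
  choose c hc0 hc using hrefl
  have hcpos : ∀ i, 0 < c i := by
    intro i
    -- Without a change of direction the vertex lies on the segment between its neighbours, dividing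
    -- it in the ratio `a : b` of the edge lengths.
    refine (hc0 i).lt_of_ne fun h => hseg i ?_
    have h1 := hc i
    rw [← h, zero_smul, sub_eq_zero] at h1
    rw [hstep (i + 1), ← h1]
    set a := ‖q (i + 1) - q i‖ with ha
    set b := ‖q (i + 1 + 1) - q (i + 1)‖ with hb
    have ha0 : 0 < a := hnorm i
    have hb0 : 0 < b := hnorm (i + 1)
    have hqi : q (i + 1) = q i + a • e i := hstep i
    rw [hqi]
    refine ⟨b / (a + b), a / (a + b), by positivity, by positivity, by field_simp; ring, ?_⟩
    have h2 : b / (a + b) = 1 - a / (a + b) := by field_simp; ring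
    have h3 : a / (a + b) * (a + b) = a := by field_simp
    rw [h2]
    generalize a / (a + b) = s at h3
    calc (1 - s) • q i + s • (q i + a • e i + b • e i) = q i + (s * (a + b)) • e i := by module
      _ = q i + a • e i := by rw [h3]
  refine ⟨m + 1, q, e, fun i => ‖w i‖⁻¹ • w i, fun i => c (i - 1) * ‖w i‖, hqℓ, ?_, hqne, hstep,
    fun i => ?_, fun i => norm_smul_inv_norm (hw0 i), fun i y hy => ?_, fun i => ?_, fun i => ?_⟩
  · intro i
    exact ⟨subset_closure (ht i), (hw i).notMem_interior (hw0 i)⟩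
  · exact norm_smul_inv_norm (sub_ne_zero.2 (hqne i))
  · rw [real_inner_smul_left]
    exact mul_nonpos_of_nonneg_of_nonpos (by positivity) (hw i y hy)
  · have := norm_pos_iff.2 (hw0 i)
    have := hcpos (i - 1)
    positivity
  · rw [hc i, smul_smul, mul_assoc, mul_inv_cancel₀ (norm_ne_zero_iff.2 (hw0 _)), mul_one,
      add_sub_cancel_right]

end Normals

/-! ### Periodic piecewise linear paths on the real line. -/

section PiecewiseLinear

lemma exists_int_primitive (τ : ℤ → ℝ) : ∃ T : ℤ → ℝ, T 0 = 0 ∧ ∀ k, T (k + 1) = T k + τ k := by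
  refine ⟨fun k => ∑ j ∈ Finset.range k.toNat, τ j - ∑ j ∈ Finset.range (-k).toNat, τ (-(j + 1)),
    by simp, fun k => ?_⟩
  rcases k with n | n
  · have h1 : (Int.ofNat n + 1).toNat = n + 1 := by simp
    have h2 : (-(Int.ofNat n + 1)).toNat = 0 := by simp
    have h3 : (-(Int.ofNat n)).toNat = 0 := by simp
    simp only [h1, h2, h3, Finset.sum_range_succ]
    simp
  · have h1 : (Int.negSucc n + 1).toNat = 0 := by omega
    have h2 : (-(Int.negSucc n + 1)).toNat = n := by omega
    have h3 : (-(Int.negSucc n)).toNat = n + 1 := by omega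
    have h4 : (Int.negSucc n).toNat = 0 := by omega
    simp only [h1, h2, h3, h4, Finset.sum_range_succ]
    rw [Int.negSucc_eq]
    simp

/-- Breakpoints `T k`, `k : ℤ`, of a subdivision of the real line into intervals of lengths `τ k`
depending periodically on `k`. -/
structure IsPeriodicSubdivision (N : ℕ) (τ T : ℤ → ℝ) : Prop where
  pos : ∀ k, 0 < τ k
  zero : T 0 = 0
  succ : ∀ k, T (k + 1) = T k + τ k
  add_period : ∀ k, T (k + N) = T k + T N
  exists_mem_Ico : ∀ t, ∃ k, T k ≤ t ∧ t < T (k + 1)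

/-- Periodicity gives `T (j * N) = j * T N`, so the breakpoints are unbounded in both directions and
the intervals cover the line. -/
lemma exists_isPeriodicSubdivision {N : ℕ} (hN : 0 < N) {τ : ℤ → ℝ} (hpos : ∀ k, 0 < τ k)
    (hper : ∀ k, τ (k + N) = τ k) : ∃ T, IsPeriodicSubdivision N τ T := by
  obtain ⟨T, h0, hT⟩ := exists_int_primitive τ
  have hmono : StrictMono T := strictMono_int_of_lt_succ fun k => by linarith [hT k, hpos k]
  have hadd : ∀ k : ℤ, T (k + N) = T k + T N := by
    intro k
    induction k using Int.induction_on with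
    | zero => simp [h0]
    | succ k ih =>
      rw [add_right_comm, hT, hT, hper, ih]; ring
    | pred k ih =>
      have h1 := hT (-(k : ℤ) - 1)
      have h2 := hT (-(k : ℤ) - 1 + N)
      rw [hper] at h2
      rw [show -(k : ℤ) - 1 + N + 1 = -k + N by ring] at h2
      rw [show -(k : ℤ) - 1 + 1 = -k by ring] at h1
      linarith
  have hTN : 0 < T N := by rw [← h0]; exact hmono (by exact_mod_cast hN)
  have hmul : ∀ j : ℤ, T (j * N) = j * T N := by
    intro j
    induction j using Int.induction_on with
    | zero => simp [h0]
    | succ j ih =>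
      rw [add_mul, one_mul, hadd, ih]; push_cast; ring
    | pred j ih =>
      have h1 := hadd ((-(j : ℤ) - 1) * N)
      rw [show (-(j : ℤ) - 1) * N + N = -j * N by ring, ih] at h1
      push_cast at h1 ⊢
      linarith
  refine ⟨T, hpos, h0, hT, hadd, fun t => ?_⟩
  obtain ⟨a, ha⟩ := exists_int_lt (t / T N)
  obtain ⟨b, hb⟩ := exists_int_gt (t / T N)
  rw [lt_div_iff₀ hTN, ← hmul] at ha
  rw [div_lt_iff₀ hTN, ← hmul] at hb
  obtain ⟨k, hk, hk'⟩ := Int.exists_greatest_of_bdd (P := fun k => T k ≤ t)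
    ⟨b * N, fun z hz => (hmono.lt_iff_lt.1 (hz.trans_lt hb)).le⟩ ⟨a * N, ha.le⟩
  refine ⟨k, hk, ?_⟩
  by_contra! h
  have := hk' (k + 1) h
  omega

lemma IsPeriodicSubdivision.strictMono {N : ℕ} {τ T : ℤ → ℝ} (h : IsPeriodicSubdivision N τ T) :
    StrictMono T :=
  strictMono_int_of_lt_succ fun k => by linarith [h.succ k, h.pos k]

lemma IsPeriodicSubdivision.exists_mem_Ioc {N : ℕ} {τ T : ℤ → ℝ}
    (h : IsPeriodicSubdivision N τ T) (t : ℝ) : ∃ k, T k < t ∧ t ≤ T (k + 1) := by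
  obtain ⟨k, hk, hk'⟩ := h.exists_mem_Ico t
  rcases hk.lt_or_eq with hlt | heq
  · exact ⟨k, hlt, hk'.le⟩
  · exact ⟨k - 1, heq ▸ h.strictMono (by omega), by rw [sub_add_cancel, heq]⟩

variable {F : Type*} [NormedAddCommGroup F] [NormedSpace ℝ F]

/-- The path `γ` is affine with velocity `v k` and starting point `V k` on the `k`-th interval of
the subdivision `T`. -/
def IsPiecewiseLinear (T : ℤ → ℝ) (V v : ℤ → F) (γ : ℝ → F) : Prop :=
  ∀ k, ∀ t ∈ Set.Icc (T k) (T (k + 1)), γ t = V k + (t - T k) • v k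

/-- `hVv` makes consecutive pieces agree at breakpoints, so evaluating on half-open intervals gives
the right value on closed ones. -/
lemma IsPeriodicSubdivision.exists_isPiecewiseLinear {N : ℕ} {τ T : ℤ → ℝ}
    (h : IsPeriodicSubdivision N τ T) {V v : ℤ → F} (hV : ∀ k, V (k + N) = V k)
    (hv : ∀ k, v (k + N) = v k) (hVv : ∀ k, V (k + 1) = V k + τ k • v k) :
    ∃ γ, IsPiecewiseLinear T V v γ ∧ Function.Periodic γ (T N) := by
  choose κ hκ hκ' using h.exists_mem_Ico
  have huniq : ∀ k t, T k ≤ t → t < T (k + 1) → κ t = k := by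
    intro k t h1 h2
    have h3 := h.strictMono.lt_iff_lt.1 ((hκ t).trans_lt h2)
    have h4 := h.strictMono.lt_iff_lt.1 (h1.trans_lt (hκ' t))
    omega
  refine ⟨fun t => V (κ t) + (t - T (κ t)) • v (κ t), fun k t ht => ?_, fun t => ?_⟩
  · rcases ht.2.lt_or_eq with hlt | heq
    · simp only [huniq k t ht.1 hlt]
    · have h1 : κ t = k + 1 := huniq _ _ heq.ge (heq.trans_lt (h.strictMono (by omega)))
      simp only [h1]
      rw [heq, sub_self, zero_smul, add_zero, hVv, h.succ, add_sub_cancel_left]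
  · have h1 : κ (t + T N) = κ t + N := by
      refine huniq _ _ ?_ ?_
      · rw [h.add_period]; linarith [hκ t]
      · rw [add_right_comm, h.add_period]; linarith [hκ' t]
    simp only [h1, hV, hv, h.add_period, add_sub_add_right_eq_sub]

lemma hasDerivAt_add_sub_smul (a v : F) (s t : ℝ) :
    HasDerivAt (fun u : ℝ => a + (u - s) • v) v t := by
  simpa using (((hasDerivAt_id t).sub_const s).smul_const v).const_add a

namespace IsPiecewiseLinear

variable {T : ℤ → ℝ} {V v : ℤ → F} {γ : ℝ → F}

lemma hasDerivWithinAt_Ici (hγ : IsPiecewiseLinear T V v γ) {k : ℤ} {t : ℝ} (h1 : T k ≤ t)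
    (h2 : t < T (k + 1)) : HasDerivWithinAt γ (v k) (Set.Ici t) t := by
  refine (hasDerivAt_add_sub_smul (V k) (v k) (T k) t).hasDerivWithinAt.congr_of_eventuallyEq
    ?_ (hγ k t ⟨h1, h2.le⟩)
  filter_upwards [Icc_mem_nhdsGE h2] with u hu using hγ k u ⟨h1.trans hu.1, hu.2⟩

lemma hasDerivWithinAt_Iic (hγ : IsPiecewiseLinear T V v γ) {k : ℤ} {t : ℝ} (h1 : T k < t)
    (h2 : t ≤ T (k + 1)) : HasDerivWithinAt γ (v k) (Set.Iic t) t := by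
  refine (hasDerivAt_add_sub_smul (V k) (v k) (T k) t).hasDerivWithinAt.congr_of_eventuallyEq
    ?_ (hγ k t ⟨h1.le, h2⟩)
  filter_upwards [Icc_mem_nhdsLE h1] with u hu using hγ k u ⟨hu.1, hu.2.trans h2⟩

lemma contDiffAt (hγ : IsPiecewiseLinear T V v γ) {k : ℤ} {t : ℝ} (h1 : T k < t)
    (h2 : t < T (k + 1)) : ContDiffAt ℝ ∞ γ t := by
  have h3 : ContDiff ℝ ∞ fun u : ℝ => V k + (u - T k) • v k := by fun_prop
  refine h3.contDiffAt.congr_of_eventuallyEq ?_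
  filter_upwards [Icc_mem_nhds h1 h2] with u hu using hγ k u hu

lemma continuous (hγ : IsPiecewiseLinear T V v γ) {N : ℕ} {τ : ℤ → ℝ}
    (h : IsPeriodicSubdivision N τ T) : Continuous γ := by
  rw [continuous_iff_continuousAt]
  intro t
  obtain ⟨k, hk, hk'⟩ := h.exists_mem_Ico t
  obtain ⟨l, hl, hl'⟩ := h.exists_mem_Ioc t
  exact continuousAt_iff_continuous_left_right.2
    ⟨(hγ.hasDerivWithinAt_Iic hl hl').continuousWithinAt,
      (hγ.hasDerivWithinAt_Ici hk hk').continuousWithinAt⟩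

lemma eVariationOn_Icc_le (hγ : IsPiecewiseLinear T V v γ) {k : ℤ} (hk : T k ≤ T (k + 1)) :
    eVariationOn γ (Set.Icc (T k) (T (k + 1))) ≤
      ENNReal.ofReal ((T (k + 1) - T k) * ‖v k‖) := by
  have hlip : LipschitzOnWith ‖v k‖₊ γ (Set.Icc (T k) (T (k + 1))) := by
    refine LipschitzOnWith.of_dist_le_mul fun s hs t ht => ?_
    rw [hγ k s hs, hγ k t ht, dist_add_left, dist_eq_norm, ← sub_smul, norm_smul,
      sub_sub_sub_cancel_right, mul_comm, Real.dist_eq]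
    rfl
  refine (hlip.comp_eVariationOn_le (g := id) (Set.mapsTo_id _)).trans ?_
  have h1 : eVariationOn (id : ℝ → ℝ) (Set.Icc (T k) (T (k + 1))) ≤
      ENNReal.ofReal (T (k + 1) - T k) := by
    have := (monotone_id.monotoneOn (Set.Icc (T k) (T (k + 1)))).eVariationOn_eq
      (Set.left_mem_Icc.2 hk) (Set.right_mem_Icc.2 hk)
    rw [Set.inter_self] at this
    exact this.le
  rw [ENNReal.ofReal_mul (sub_nonneg.2 hk), mul_comm (ENNReal.ofReal _), ofReal_norm]
  exact mul_le_mul_right h1 _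

lemma eVariationOn_le (hγ : IsPiecewiseLinear T V v γ) {N : ℕ} {τ : ℤ → ℝ}
    (h : IsPeriodicSubdivision N τ T) (n : ℕ) :
    eVariationOn γ (Set.Icc 0 (T n)) ≤
      ENNReal.ofReal (∑ k ∈ Finset.range n, τ k * ‖v k‖) := by
  have hmono : Monotone fun k : ℕ => T k := fun a b hab =>
    h.strictMono.monotone (by exact_mod_cast hab)
  have h1 := eVariationOn.sum' γ hmono (n := n)
  simp only [Nat.cast_zero, h.zero] at h1
  rw [← h1, ENNReal.ofReal_sum_of_nonneg
    fun k _ => mul_nonneg (h.pos _).le (norm_nonneg _)]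
  refine Finset.sum_le_sum fun k _ => ?_
  have h2 := hγ.eVariationOn_Icc_le (k := k) (h.strictMono.monotone (by omega))
  rw [h.succ, add_sub_cancel_left, ← h.succ] at h2
  exact_mod_cast h2

end IsPiecewiseLinear

end PiecewiseLinear

/-! ### Alternating two kinds of phases. -/

/-- The sequence `a 0, b 0, a 1, b 1, …`. -/
def interleave {α : Type*} (a b : ℤ → α) (k : ℤ) : α :=
  if Even k then a (k / 2) else b (k / 2)

lemma interleave_even {α : Type*} (a b : ℤ → α) (i : ℤ) : interleave a b (2 * i) = a i := by
  simp [interleave]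

lemma interleave_odd {α : Type*} (a b : ℤ → α) (i : ℤ) : interleave a b (2 * i + 1) = b i := by
  have h1 : ¬ Even (2 * i + 1) := by simp
  have h2 : (2 * i + 1) / 2 = i := by omega
  rw [interleave, if_neg h1, h2]

lemma interleave_periodic {α : Type*} {a b : ℤ → α} {m : ℕ} (ha : ∀ i, a (i + m) = a i)
    (hb : ∀ i, b (i + m) = b i) (k : ℤ) :
    interleave a b (k + (2 * m : ℕ)) = interleave a b k := by
  obtain ⟨i, rfl | rfl⟩ := Int.even_or_odd' k
  · rw [show 2 * i + ((2 * m : ℕ) : ℤ) = 2 * (i + m) by push_cast; ring]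
    simp only [interleave_even, ha]
  · rw [show 2 * i + 1 + ((2 * m : ℕ) : ℤ) = 2 * (i + m) + 1 by push_cast; ring]
    simp only [interleave_odd, hb]

lemma sum_range_two_mul (f : ℕ → ℝ) (m : ℕ) :
    ∑ k ∈ Finset.range (2 * m), f k = ∑ i ∈ Finset.range m, (f (2 * i) + f (2 * i + 1)) := by
  induction m with
  | zero => simp
  | succ m ih =>
    rw [mul_add, mul_one, Finset.sum_range_succ, Finset.sum_range_succ, ih, Finset.sum_range_succ]
    ring

lemma sum_range_eq_sum_zmod {m : ℕ} (g : ZMod (m + 1) → ℝ) :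
    ∑ i ∈ Finset.range (m + 1), g ((i : ℤ) : ZMod (m + 1)) = ∑ i, g i := by
  rw [← Fin.sum_univ_eq_sum_range fun i : ℕ => g ((i : ℤ) : ZMod (m + 1))]
  refine Finset.sum_congr rfl fun i _ => congrArg g ?_
  rw [Int.cast_natCast]
  exact ZMod.natCast_zmod_val (n := m + 1) i

/-! ### From a billiard polygon to a closed trajectory, and the inradius bound. -/

section Trajectory

variable {n : ℕ}

/-- If some closed polygon of length at most `ℓ` does not fit into the interior of a convex body
`K`, then there is a closed billiard trajectory in `K` of length at most `ℓ`. -/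
lemma shortestBilliardLength_le_of_not_fitsInto {K : Set (EuclideanSpace ℝ (Fin n))}
    (hK : IsCompact K) (hconv : Convex ℝ K) (hne : (interior K).Nonempty) {ℓ : ℝ} {m₀ : ℕ}
    {x₀ : ZMod (m₀ + 1) → EuclideanSpace ℝ (Fin n)}
    (hx₀ : ¬ FitsInto (interior K) x₀) (hℓ : cyclicLength x₀ ≤ ℓ) :
    shortestBilliardLength K ≤ ENNReal.ofReal ℓ := by
  obtain ⟨m, q, e, ν, c, hqℓ, hq, hqne, hstep, he, hν, hnor, hc, hrefl⟩ :=
    exists_billiard_polygon hK hconv hne hx₀ hℓ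
  have hclosed : IsClosed K := hK.isClosed
  have hcast : ∀ i : ℤ, ((i + (m + 1 : ℕ) : ℤ) : ZMod (m + 1)) = i := fun i => by
    rw [Int.cast_add, Int.cast_natCast, ZMod.natCast_self, add_zero]
  have hcast' : ∀ i : ℤ, ((i + 1 : ℤ) : ZMod (m + 1)) = i + 1 := fun i => by push_cast; rfl
  -- Even phases are flights, odd phases are jumps. Flights have unit speed, hence last as long as
  -- the edge; jumps move `p` with velocity `ν (i + 1)`, hence last `c (i + 1)`. Thus `d = 1`
  -- throughout.
  set τ : ℤ → ℝ := interleave (fun i => ‖q ((i : ZMod (m + 1)) + 1) - q i‖)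
    (fun i => c ((i : ZMod (m + 1)) + 1)) with hτ
  set Vq : ℤ → EuclideanSpace ℝ (Fin n) :=
    interleave (fun i => q i) (fun i => q ((i : ZMod (m + 1)) + 1)) with hVq
  set vq : ℤ → EuclideanSpace ℝ (Fin n) := interleave (fun i => e i) (fun _ => 0) with hvq
  set Vp : ℤ → EuclideanSpace ℝ (Fin n) :=
    interleave (fun i => -e i) (fun i => -e i) with hVp
  set vp : ℤ → EuclideanSpace ℝ (Fin n) :=
    interleave (fun _ => 0) (fun i => ν ((i : ZMod (m + 1)) + 1)) with hvp
  have hnext : ∀ i : ℤ, 2 * i + 1 + 1 = 2 * (i + 1) := fun i => by ring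
  have hτpos : ∀ k, 0 < τ k := fun k => by
    obtain ⟨i, rfl | rfl⟩ := Int.even_or_odd' k
    · rw [hτ, interleave_even]; exact norm_pos_iff.2 (sub_ne_zero.2 (hqne _))
    · rw [hτ, interleave_odd]; exact hc _
  obtain ⟨T, hT⟩ := exists_isPeriodicSubdivision (N := 2 * (m + 1)) (by omega) hτpos
    (interleave_periodic (fun i => by simp only [hcast]) (fun i => by simp only [hcast]))
  obtain ⟨γq, hγq, hγqper⟩ := hT.exists_isPiecewiseLinear (V := Vq) (v := vq)
    (interleave_periodic (fun i => by simp only [hcast]) (fun i => by simp only [hcast]))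
    (interleave_periodic (fun i => by simp only [hcast]) (fun i => rfl)) (fun k => by
      obtain ⟨i, rfl | rfl⟩ := Int.even_or_odd' k
      · simp only [hτ, hVq, hvq, interleave_even, interleave_odd]; exact hstep _
      · simp only [hτ, hVq, hvq, hnext, interleave_even, interleave_odd, hcast', smul_zero,
          add_zero])
  obtain ⟨γp, hγp, hγpper⟩ := hT.exists_isPiecewiseLinear (V := Vp) (v := vp)
    (interleave_periodic (fun i => by simp only [hcast]) (fun i => by simp only [hcast]))
    (interleave_periodic (fun i => rfl) (fun i => by simp only [hcast])) (fun k => by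
      obtain ⟨i, rfl | rfl⟩ := Int.even_or_odd' k
      · simp only [hVp, hvp, interleave_even, interleave_odd, smul_zero, add_zero]
      · simp only [hτ, hVp, hvp, hnext, interleave_even, interleave_odd, hcast', ← hrefl]
        abel)
  have hflight : ∀ i : ℤ, ∀ t ∈ Set.Icc (T (2 * i)) (T (2 * i + 1)),
      γq t ∈ K ∧ γp t = -e i := by
    intro i t ht
    have h1 := hγq _ t ht
    have h2 := hγp _ t ht
    simp only [hVq, hvq, hVp, hvp, interleave_even, smul_zero, add_zero] at h1 h2
    refine ⟨?_, h2⟩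
    have h3 := hT.succ (2 * i)
    have h4 := hτpos (2 * i)
    have h5 : T (2 * i) ≤ t := ht.1
    have h6 : t ≤ T (2 * i + 1) := ht.2
    have h7 : q ((i : ZMod (m + 1)) + 1) - q i = ‖q ((i : ZMod (m + 1)) + 1) - q i‖ • e i := by
      rw [sub_eq_iff_eq_add']; exact hstep i
    simp only [hτ, interleave_even] at h3 h4
    have h8 := hconv.add_smul_sub_mem (hclosed.frontier_subset (hq i))
      (hclosed.frontier_subset (hq (i + 1)))
      (t := (t - T (2 * i)) / ‖q ((i : ZMod (m + 1)) + 1) - q i‖)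
      ⟨by apply div_nonneg <;> linarith, by rw [div_le_one h4]; linarith⟩
    convert h8 using 1
    rw [h1]
    nth_rw 2 [h7]
    rw [smul_smul, div_mul_cancel₀ _ h4.ne']
  have hjump : ∀ i : ℤ, ∀ t ∈ Set.Icc (T (2 * i + 1)) (T (2 * i + 1 + 1)),
      γq t = q ((i : ZMod (m + 1)) + 1) ∧
      γp t = -e i + (t - T (2 * i + 1)) • ν ((i : ZMod (m + 1)) + 1) ∧
      γp t ∈ Metric.closedBall 0 1 := by
    intro i t ht
    have h1 := hγq _ t ht
    have h2 := hγp _ t ht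
    simp only [hVq, hvq, hVp, hvp, interleave_odd, smul_zero, add_zero] at h1 h2
    refine ⟨h1, h2, ?_⟩
    have h3 := hT.succ (2 * i + 1)
    have h4 := hτpos (2 * i + 1)
    have h5 : T (2 * i + 1) ≤ t := ht.1
    have h6 : t ≤ T (2 * i + 1 + 1) := ht.2
    simp only [hτ, interleave_odd] at h3 h4
    have hball : ∀ j, -e j ∈ Metric.closedBall (0 : EuclideanSpace ℝ (Fin n)) 1 := fun j => by
      simp [he j]
    have h8 := (convex_closedBall (0 : EuclideanSpace ℝ (Fin n)) 1).add_smul_sub_mem (hball i)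
      (hball (i + 1)) (t := (t - T (2 * i + 1)) / c ((i : ZMod (m + 1)) + 1))
      ⟨by apply div_nonneg <;> linarith, by rw [div_le_one h4]; linarith⟩
    convert h8 using 1
    rw [h2, show -e ((i : ZMod (m + 1)) + 1) - -e i = e i - e (i + 1) by abel, hrefl, smul_smul,
      div_mul_cancel₀ _ h4.ne']
  have hbounce : ∀ k : ℤ, ∀ t ∈ Set.Icc (T k) (T (k + 1)), γq t ∈ frontier K →
      IsBounceVelocity K (γq t) (γp t) (vq k) (vp k) := by
    intro k t ht hfr
    obtain ⟨i, rfl | rfl⟩ := Int.even_or_odd' k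
    -- During a flight `β = 0`, so any outward normal can serve as `ν`; this also covers edges lying
    -- in the boundary.
    · obtain ⟨w, hw, hw'⟩ := exists_unit_outwardNormal hconv hne hfr.2
      refine ⟨1, 0, w, zero_le_one, le_rfl, by simp, ⟨hw, hw'⟩, ?_, ?_⟩
      · rw [hvq, interleave_even, (hflight i t ht).2]; simp
      · rw [hvp, interleave_even]; simp
    · refine ⟨0, 1, ν ((i : ZMod (m + 1)) + 1), le_rfl, zero_le_one, by simp,
        ⟨hν _, ?_⟩, ?_, ?_⟩
      · rw [(hjump i t ht).1]; exact hnor _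
      · rw [hvq, interleave_odd]; simp
      · rw [hvp, interleave_odd]; simp
  have hinterior : ∀ k : ℤ, ∀ t ∈ Set.Icc (T k) (T (k + 1)), γq t ∈ interior K →
      vq k = -γp t ∧ vp k = 0 := by
    intro k t ht hint
    obtain ⟨i, rfl | rfl⟩ := Int.even_or_odd' k
    · rw [hvq, hvp, interleave_even, interleave_even, (hflight i t ht).2]; simp
    · rw [(hjump i t ht).1] at hint
      exact ((hq _).2 hint).elim
  have hderiv : ∀ {γ : ℝ → EuclideanSpace ℝ (Fin n)} {a : EuclideanSpace ℝ (Fin n)} {t : ℝ},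
      HasDerivWithinAt γ a (Set.Iic t) t → HasDerivWithinAt γ a (Set.Ici t) t →
        HasDerivAt γ a t := fun h1 h2 => by
    have := h1.union h2
    rwa [Set.Iic_union_Ici, hasDerivWithinAt_univ] at this
  have htraj : IsClosedBilliardTrajectory K (T (2 * (m + 1) : ℕ)) γq γp :=
  { period_pos := by
      rw [← hT.zero]; exact hT.strictMono (by positivity)
    periodic_q := hγqper
    periodic_p := hγpper
    continuous_q := hγq.continuous hT
    continuous_p := hγp.continuous hT
    smooth_ae := by
      have h1 : ∀ᵐ t : ℝ, t ∉ Set.range T :=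
        (Set.countable_range T).ae_notMem MeasureTheory.volume
      filter_upwards [h1] with t ht
      obtain ⟨k, hk, hk'⟩ := hT.exists_mem_Ico t
      have hlt : T k < t := hk.lt_of_ne fun h => ht ⟨k, h⟩
      exact ⟨hγq.contDiffAt hlt hk', hγp.contDiffAt hlt hk'⟩
    mem_boundary := fun t => by
      rw [frontier_prod_eq, frontier_closedBall _ one_ne_zero, Metric.isClosed_closedBall.closure_eq,
        hclosed.closure_eq]
      obtain ⟨k, hk, hk'⟩ := hT.exists_mem_Ico t
      obtain ⟨i, rfl | rfl⟩ := Int.even_or_odd' k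
      · obtain ⟨h1, h2⟩ := hflight i t ⟨hk, hk'.le⟩
        exact Or.inl ⟨h1, by simp [h2, he]⟩
      · obtain ⟨h1, -, h2⟩ := hjump i t ⟨hk, hk'.le⟩
        exact Or.inr ⟨by rw [h1]; exact hq _, h2⟩
    velocity := by
      refine ⟨1, one_pos, fun t ht _ => ?_, fun t _ ht => ?_⟩
      · obtain ⟨k, hk, hk'⟩ := hT.exists_mem_Ico t
        obtain ⟨l, hl, hl'⟩ := hT.exists_mem_Ioc t
        obtain ⟨h1, h2⟩ := hinterior k t ⟨hk, hk'.le⟩ ht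
        obtain ⟨h3, h4⟩ := hinterior l t ⟨hl.le, hl'⟩ ht
        rw [one_smul]
        constructor
        · exact hderiv (h3 ▸ hγq.hasDerivWithinAt_Iic hl hl') (h1 ▸ hγq.hasDerivWithinAt_Ici hk hk')
        · exact hderiv (h4 ▸ hγp.hasDerivWithinAt_Iic hl hl') (h2 ▸ hγp.hasDerivWithinAt_Ici hk hk')
      · obtain ⟨k, hk, hk'⟩ := hT.exists_mem_Ico t
        rw [mem_ball_zero_iff] at ht
        obtain ⟨i, rfl | rfl⟩ := Int.even_or_odd' k
        · rw [(hflight i t ⟨hk, hk'.le⟩).2, norm_neg, he] at ht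
          exact (lt_irrefl _ ht).elim
        · obtain ⟨h1, h2, -⟩ := hjump i t ⟨hk, hk'.le⟩
          -- At the start of a jump `p` is still a unit vector, so `t` is interior to the phase and
          -- the two one-sided derivatives agree.
          have hlt : T (2 * i + 1) < t := by
            refine hk.lt_of_ne fun h => ?_
            rw [h2, h, sub_self, zero_smul, add_zero, norm_neg, he] at ht
            exact lt_irrefl _ ht
          have h3 := hderiv (hγq.hasDerivWithinAt_Iic hlt hk'.le) (hγq.hasDerivWithinAt_Ici hk hk')
          have h4 := hderiv (hγp.hasDerivWithinAt_Iic hlt hk'.le) (hγp.hasDerivWithinAt_Ici hk hk')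
          rw [hvq, interleave_odd] at h3
          rw [hvp, interleave_odd] at h4
          exact ⟨ν ((i : ZMod (m + 1)) + 1), ⟨hν _, by rw [h1]; exact hnor _⟩, h3, by
            rwa [one_smul]⟩
    bounce_right := fun t ht _ => by
      obtain ⟨k, hk, hk'⟩ := hT.exists_mem_Ico t
      exact ⟨_, _, hγq.hasDerivWithinAt_Ici hk hk', hγp.hasDerivWithinAt_Ici hk hk',
        hbounce k t ⟨hk, hk'.le⟩ ht⟩
    bounce_left := fun t ht _ => by
      obtain ⟨k, hk, hk'⟩ := hT.exists_mem_Ioc t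
      exact ⟨_, _, hγq.hasDerivWithinAt_Iic hk hk', hγp.hasDerivWithinAt_Iic hk hk',
        hbounce k t ⟨hk.le, hk'⟩ ht⟩ }
  have hle : shortestBilliardLength K ≤ eVariationOn γq (Set.Icc 0 (T (2 * (m + 1) : ℕ))) :=
    sInf_le ⟨_, _, _, htraj, rfl⟩
  refine hle.trans ((hγq.eVariationOn_le hT _).trans
    (ENNReal.ofReal_le_ofReal (le_trans (le_of_eq ?_) hqℓ)))
  -- Jumps contribute nothing to the length of `q`, and flights contribute exactly the edge lengths.
  rw [sum_range_two_mul fun k : ℕ => τ k * ‖vq k‖, cyclicLength, ← sum_range_eq_sum_zmod]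
  refine Finset.sum_congr rfl fun i _ => ?_
  push_cast
  simp only [hτ, hvq, interleave_even, interleave_odd, he, norm_zero, mul_zero, mul_one, add_zero]
  push_cast
  rfl

/-- The real supremum defaults to zero on unbounded sets, so the radii must be bounded. For this a
vector of norm `s` is needed, which exists because `1 ≤ n`: a ball of radius `s` then has diameter
`2 * s`. -/
lemma not_closedBall_subset_of_inradius_lt (hn : 1 ≤ n) {K : Set (EuclideanSpace ℝ (Fin n))}
    (hK : IsCompact K) {r : ℝ} (hr : 0 ≤ r) (h : inradius K < r) (c : EuclideanSpace ℝ (Fin n)) :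
    ¬ Metric.closedBall c r ⊆ K := by
  intro hc
  refine h.not_ge (le_csSup ?_ ⟨hr, c, hc⟩)
  obtain ⟨R, hR⟩ := hK.isBounded.subset_closedBall (0 : EuclideanSpace ℝ (Fin n))
  refine ⟨R, ?_⟩
  rintro s ⟨hs, x, hx⟩
  set u : EuclideanSpace ℝ (Fin n) := EuclideanSpace.single ⟨0, hn⟩ s with hu
  have hnorm : ‖u‖ = s := by simp [hu, abs_of_nonneg hs]
  have h1 := mem_closedBall_zero_iff.1 (hR (hx (show x + u ∈ _ by simp [hnorm])))
  have h2 := mem_closedBall_zero_iff.1 (hR (hx (show x - u ∈ _ by simp [hnorm])))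
  have h3 := norm_sub_le (x + u) (x - u)
  have h4 : x + u - (x - u) = (2 : ℝ) • u := by module
  rw [h4, norm_smul, hnorm] at h3
  norm_num at h3
  linarith

end Trajectory

theorem mainTheorem3 (n : ℕ) (hn : 1 ≤ n) (K : Set (EuclideanSpace ℝ (Fin n)))
    (hK : IsSmoothConvexBody K) :
    shortestBilliardLength K ≤ ENNReal.ofReal (2 * ((n : ℝ) + 1) * inradius K) := by
  have hin : 0 ≤ inradius K := Real.sSup_nonneg fun r hr => hr.1
  -- Helly's theorem is applied to a ball that does not fit, so `r` must exceed the inradius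
  -- strictly; the bound itself follows in the limit.
  have key : ∀ r, inradius K < r →
      shortestBilliardLength K ≤ ENNReal.ofReal (2 * ((n : ℝ) + 1) * r) := by
    intro r hr
    have hr0 : 0 ≤ r := hin.trans hr.le
    obtain ⟨x, hx, hxK⟩ := exists_not_fitsInto_of_closedBall hK.isCompact hK.convex hr0
      (not_closedBall_subset_of_inradius_lt hn hK.isCompact hr0 hr)
    refine shortestBilliardLength_le_of_not_fitsInto hK.isCompact hK.convex hK.interior_nonempty
      (fun h => hxK (h.mono interior_subset)) ?_
    simpa using cyclicLength_le_of_norm_le hx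
  have hlim : Filter.Tendsto (fun r : ℝ => ENNReal.ofReal (2 * ((n : ℝ) + 1) * r))
      (nhdsWithin (inradius K) (Set.Ioi (inradius K)))
      (nhds (ENNReal.ofReal (2 * ((n : ℝ) + 1) * inradius K))) := by
    have : Continuous fun r : ℝ => ENNReal.ofReal (2 * ((n : ℝ) + 1) * r) :=
      ENNReal.continuous_ofReal.comp (by fun_prop)
    exact (this.tendsto _).mono_left nhdsWithin_le_nhds
  refine ge_of_tendsto hlim ?_
  filter_upwards [self_mem_nhdsWithin] with r hr using key r hr
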